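/- Conventions. In a finite poset, the height of an element is the length (number of steps) of a longest chain ending at it, so minimal elements have height $0$; the poset is ranked if $\mathrm{height}(y)=\mathrm{height}(x)+1$ for every covering relation $x\lessdot y$. Let $P$ be a finite ranked poset with element set $V=\{1,\dots,n\}$ (the order of $P$ being unrelated to that of the integers), and let $V_0$ and $V_1$ be the sets of elements of even and odd height. A function $r:V\to\{1,2,3,\dots\}$ satisfies the order condition if $r(x)\le r(y)$ whenever $x\le_P y$, and $r(x)<r(y)$ whenever $x<_P y$ and $x\in V_1$. With noncommuting variables $a_i$, resp. $b_i,d_i$ ($i\ge1$), and rational coefficients, set $$F_P(a_1,a_2,\dots)=\sum_{r} a_{r(1)}a_{r(2)}\cdots a_{r(n)},\qquad N_P\begin{pmatrix} b_1&b_2&\dots\\ d_1&d_2&\dots\end{pmatrix}=\sum_r c_{1,r(1)}c_{2,r(2)}\cdots c_{n,r(n)},$$ both sums being over the $r$ satisfying the order condition, where $c_{v,i}=b_i$ if $v\in V_0$ and $c_{v,i}=d_i$ if $v\in V_1$. The packed word of a word $w$ over the positive integers is obtained by replacing the $k$-th smallest letter occurring in $w$ by $k$, for every $k$; $u$ is packed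 if it is its own packed word. The functions $M_u=\sum_{w:\,\mathrm{pack}(w)=u}a_{w_1}a_{w_2}\cdots$, for $u$ packed, form a basis of the space $\mathbf{WQSym}$, and $F_P\in\mathbf{WQSym}$. For an integer $m\ge0$, define the virtual alphabet $\mathbb A_m=\ominus(a_1)\oplus(a_2)\ominus(a_3)\cdots\ominus(a_{2m+1})$, where $$a_{2i+1}=d_{i+1}+\cdots+d_m+b_{i+1}+\cdots+b_{m+1}\ (0\le i\le m),\qquad a_{2i}=d_i+\cdots+d_m+b_{i+1}+\cdots+b_{m+1}\ (1\le i\le m).$$ For a packed word $u=u_1\cdots u_n$ with greatest letter $k$ ($k=0$ if $u$ is empty), put $$M_u(\mathbb A_m)=\sum_{f}(-1)^{\#\{t\,:\,f(t)\text{ odd}\}}\,a_{f(u_1)}a_{f(u_2)}\cdots a_{f(u_n)},$$ the sum being over all weakly increasing maps $f:\{1,\dots,k\}\to\{1,\dots,2m+1\}$ taking each even value at most once, and extend $G\mapsto G(\mathbb A_m)$ linearly to $\mathbf{WQSym}$. Theorem. For every ranked poset $P$ on $V=V_0\sqcup V_1=\{1,\dots,n\}$ and every integer $m\ge 0$, $$N_P\begin{pmatrix}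 b_1&\dots&b_m&b_{m+1}\\ d_1&\dots&d_m&\end{pmatrix}=(-1)^{|V_0|}\,F_P(\mathbb A_m),$$ where on the left $b_i$ for $i>m+1$ and $d_i$ for $i>m$ are replaced by $0$; this is an identity of polynomials in the noncommuting variables $b_1,\dots,b_{m+1},d_1,\dots,d_m$. -/

import Mathlib

namespace NCPartition

/-! ### Ranked posets and the order condition -/

section Posets

variable {V : Type*} [PartialOrder V]

/-- The height of an element: the length of a longest chain ending at it
(minimal elements have height `0`). It is only used in finite posets, where it is finite. -/
noncomputable def height (x : V) : ℕ := (Order.height x).toNat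

variable (V) in
/-- A poset is ranked if every covering relation raises the height by exactly one. -/
def IsRanked : Prop := ∀ x y : V, x ⋖ y → height y = height x + 1

/-- The order condition on a function `r` from the poset to the positive integers: `r` is
non-decreasing, and `r x < r y` whenever `x < y` and `x` has odd height. -/
def OrderCondition (r : V → ℕ+) : Prop :=
  Monotone r ∧ ∀ x y : V, x < y → Odd (height x) → r x < r y

end Posets

/-! ### Series in noncommuting variables -/

/-- Formal series (infinite linear combinations of words) with rational coefficients in
noncommuting variables indexed by `X`: `f w` is the coefficient of the word `w`. -/
abbrev WordSeries (X : Type*) : Type _ := List X → ℚ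

/-- The formal sum `∑ r, word r` over the `r` with `p r`: the coefficient of `w` is the number of
such `r` with `word r = w` (finite in all the cases below). -/
noncomputable def formalSum {ι X : Type*} (p : ι → Prop) (word : ι → List X) : WordSeries X :=
  fun w => (Nat.card {r : ι // p r ∧ word r = w} : ℚ)

/-- Substitution of the element `x i` of an algebra for the variable `i`: `∑ w, f w • x(w)`.
It is used where only finitely many terms are nonzero. -/
noncomputable def WordSeries.subst {X A : Type*} [Ring A] [Algebra ℚ A]
    (f : WordSeries X) (x : X → A) : A :=
  ∑ᶠ w : List X, f w • (w.map x).prod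

/-! ### The two generating series of a labeled poset

A labeled poset on `{1, …, n}` is given as a poset `V` with a bijection `label : Fin n ≃ V`;
`label i` is the element carrying the number `i + 1`. -/

section Series

variable {V : Type*} [PartialOrder V] {n : ℕ}

/-- `F_P = ∑ r, a_{r(1)} a_{r(2)} ⋯ a_{r(n)}`, over all `r` with the order condition. -/
noncomputable def F (label : Fin n ≃ V) : WordSeries ℕ+ :=
  formalSum (fun r : V → ℕ+ => OrderCondition r) (fun r => List.ofFn fun i => r (label i))

/-- The noncommuting variables `b_1, b_2, …` and `d_1, d_2, …`. -/
inductive Letter : Type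
  | b (i : ℕ+) : Letter
  | d (i : ℕ+) : Letter

open Classical in
/-- `N_P = ∑ r, bd_{r(1)} bd_{r(2)} ⋯ bd_{r(n)}`, over all `r` with the order condition, where
`bd_{r(v)}` is `b_{r(v)}` if `v` has even height and `d_{r(v)}` if `v` has odd height. -/
noncomputable def N (label : Fin n ≃ V) : WordSeries Letter :=
  formalSum (fun r : V → ℕ+ => OrderCondition r)
    (fun r => List.ofFn fun i =>
      if Even (height (label i)) then Letter.b (r (label i)) else Letter.d (r (label i)))

end Series

/-- The polynomials in the noncommuting variables `b_i`, `d_i`. -/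
abbrev Poly : Type := FreeAlgebra ℚ Letter

/-- The truncated variables: `b_i` is kept for `i ≤ m + 1` and `d_i` for `i ≤ m`; all the others
are replaced by zero. -/
noncomputable def truncatedVar (m : ℕ) : Letter → Poly
  | Letter.b i => if (i : ℕ) ≤ m + 1 then FreeAlgebra.ι ℚ (Letter.b i) else 0
  | Letter.d i => if (i : ℕ) ≤ m then FreeAlgebra.ι ℚ (Letter.d i) else 0

/-! ### Word quasi-symmetric functions -/

/-- The packed word of `w`: the `k`-th smallest letter occurring in `w` is replaced by `k`. -/
def pack (w : List ℕ+) : List ℕ+ :=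
  w.map fun a => Nat.succPNat (w.toFinset.filter (fun c => c < a)).card

/-- The type of packed words (they encode the set compositions). -/
abbrev PackedWord : Type := {u : List ℕ+ // pack u = u}

/-- The monomial word quasi-symmetric function `M_u`, the sum of all the words `w` with
packed word `u`. -/
def M (u : PackedWord) : WordSeries ℕ+ := fun w => if pack w = u.1 then 1 else 0

/-- The space `WQSym`, spanned by the functions `M_u`. -/
noncomputable def WQSym : Submodule ℚ (WordSeries ℕ+) := Submodule.span ℚ (Set.range M)

theorem M_linearIndependent : LinearIndependent ℚ M := by
  classical
  rw [linearIndependent_iff']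
  intro s g hg u hu
  have h := congrFun hg u.1
  simp only [Finset.sum_apply, Pi.smul_apply, M, smul_eq_mul, Pi.zero_apply, u.2] at h
  rw [Finset.sum_eq_single u] at h
  · simpa using h
  · intro v _ hvu
    rw [if_neg, mul_zero]
    exact fun h' => hvu (Subtype.ext h'.symm)
  · exact fun h' => absurd hu h'

/-- The basis `(M_u)` of `WQSym`. -/
noncomputable def MBasis : Module.Basis PackedWord ℚ WQSym := Module.Basis.span M_linearIndependent

/-! ### Virtual alphabets -/

/-- The sign of a letter in a virtual alphabet. -/
inductive Sign : Type
  | plus : Sign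
  | minus : Sign

/-- The multiplicity with which a group of `k` consecutive values of a packed word is sent to one
signed letter. For `⊕ (a)` it is the coefficient of `t ^ k` in `1 + t`: at most
one value can be sent to a genuine letter. For `⊖ (a)` it is the coefficient of `t ^ k` in the
inverse series `(1 + t)⁻¹`. -/
def Sign.mult : Sign → ℕ → ℤ
  | plus, k => if k ≤ 1 then 1 else 0
  | minus, k => (-1) ^ k

/-- A finite ordered sum `± (a_1) ± (a_2) ⋯ ± (a_N)` of signed letters with values in `A`. -/
structure VirtualAlphabet (A : Type*) where
  size : ℕ
  sign : Fin size → Sign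
  letter : Fin size → A

open Classical in
/-- The evaluation of `M_u` on a virtual alphabet. One sums over all the weakly increasing maps `f`
from the set of values `{1, …, k}` of `u` to the positions of the alphabet, i.e. over all the ways
to cut the ordered sequence of values into consecutive (possibly empty) groups, one for each
signed letter. Each signed letter contributes its multiplicity, and each letter `x` of the word `u`
is replaced by the letter of the alphabet at position `f x`. If all the signs are plus, only the
strictly increasing `f` contribute, and this is the usual value of `M_u` on a finite alphabet. -/
noncomputable def MEval {A : Type*} [Ring A] (S : VirtualAlphabet A) (u : PackedWord) : A :=
  ∑ f : {x // x ∈ u.1} → Fin S.size with Monotone f,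
    (∏ j : Fin S.size, (S.sign j).mult (Fintype.card {x // f x = j})) •
      (u.1.attach.map fun x => S.letter (f x)).prod

/-- The evaluation `G ↦ G(S)` of word quasi-symmetric functions on a virtual alphabet: the linear
extension of the evaluation of the basis elements `M_u`. -/
noncomputable def evalVirtual {A : Type*} [Ring A] [Algebra ℚ A] (S : VirtualAlphabet A) :
    WQSym →ₗ[ℚ] A :=
  MBasis.constr ℚ (MEval S)

/-- The linear combinations `a_1, …, a_{2m+1}` of the `b_i` and `d_i`:
`a_{2i+1} = d_{i+1} + ⋯ + d_m + b_{i+1} + ⋯ + b_{m+1}` and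
`a_{2i} = d_i + ⋯ + d_m + b_{i+1} + ⋯ + b_{m+1}`. Here `k + 1` is the index of the variables,
so that the first sum is over `k + 1 ∈ {i + 1, …, m}` (resp. `{i, …, m}`) and the second one over
`k + 1 ∈ {i + 1, …, m + 1}`, with `i = j / 2`. -/
noncomputable def aVar (m j : ℕ) : Poly :=
  if Odd j then
    ∑ k ∈ Finset.Ico (j / 2) m, FreeAlgebra.ι ℚ (Letter.d k.succPNat) +
      ∑ k ∈ Finset.Ico (j / 2) (m + 1), FreeAlgebra.ι ℚ (Letter.b k.succPNat)
  else
    ∑ k ∈ Finset.Ico (j / 2 - 1) m, FreeAlgebra.ι ℚ (Letter.d k.succPNat) +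
      ∑ k ∈ Finset.Ico (j / 2) (m + 1), FreeAlgebra.ι ℚ (Letter.b k.succPNat)

/-- The virtual alphabet `⊖ (a_1) ⊕ (a_2) ⊖ (a_3) ⋯ ⊖ (a_{2m+1})`. The position `j : Fin (2m+1)`
holds `a_{j+1}`, with sign `⊖` exactly when `j + 1` is odd. -/
noncomputable def AVirtual (m : ℕ) : VirtualAlphabet Poly where
  size := 2 * m + 1
  sign := fun j => if Odd (j.1 + 1) then Sign.minus else Sign.plus
  letter := fun j => aVar m (j.1 + 1)

/-! ### `F_P` belongs to `WQSym` -/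

theorem pack_length (w : List ℕ+) : (pack w).length = w.length := by simp [pack]

theorem rank_lt_iff (s : Finset ℕ+) {a c : ℕ+} (ha : a ∈ s) :
    (s.filter (fun e => e < a)).card < (s.filter (fun e => e < c)).card ↔ a < c := by
  constructor
  · intro h
    by_contra hc
    refine absurd (Finset.card_le_card ?_) (not_le.mpr h)
    intro e he
    simp only [Finset.mem_filter] at he ⊢
    exact ⟨he.1, he.2.trans_le (not_lt.mp hc)⟩
  · intro h
    refine Finset.card_lt_card ⟨?_, ?_⟩
    · intro e he
      simp only [Finset.mem_filter] at he ⊢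
      exact ⟨he.1, he.2.trans h⟩
    · intro hs
      have := hs (Finset.mem_filter.mpr ⟨ha, h⟩)
      simp at this

theorem pack_pack (w : List ℕ+) : pack (pack w) = pack w := by
  classical
  set φ : ℕ+ → ℕ+ := fun a => Nat.succPNat (w.toFinset.filter (fun c => c < a)).card with hφ
  have hlt : ∀ a ∈ w.toFinset, ∀ c, (φ a < φ c ↔ a < c) := by
    intro a ha c
    rw [← rank_lt_iff w.toFinset (c := c) ha]
    simp only [hφ, ← PNat.coe_lt_coe, Nat.succPNat_coe]
    exact Nat.succ_lt_succ_iff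
  have h1 : pack w = w.map φ := rfl
  have h2 : (pack w).toFinset = w.toFinset.image φ := by
    ext x; simp [h1]
  have h3 : pack (pack w) = (pack w).map fun a =>
      Nat.succPNat ((pack w).toFinset.filter (fun c => c < a)).card := rfl
  rw [h3, h2, h1, List.map_map]
  refine List.map_congr_left fun a ha => ?_
  have ha' : a ∈ w.toFinset := List.mem_toFinset.mpr ha
  simp only [Function.comp]
  rw [Finset.filter_image, Finset.card_image_of_injOn]
  · simp only [hφ]
    congr 2
    refine Finset.filter_congr fun c hc => ?_
    exact hlt c hc a
  · intro c hc e he hce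
    simp only [Finset.coe_filter, Set.mem_ofPred_eq] at hc he
    rcases lt_trichotomy c e with h | h | h
    · exact absurd hce ((hlt c hc.1 e).2 h).ne
    · exact h
    · exact absurd hce ((hlt e he.1 c).2 h).ne'

theorem F_apply {V : Type*} [PartialOrder V] {n : ℕ} (label : Fin n ≃ V) (w : List ℕ+)
    [Decidable (∃ r : V → ℕ+, OrderCondition r ∧ List.ofFn (fun i => r (label i)) = w)] :
    F label w =
      if ∃ r : V → ℕ+, OrderCondition r ∧ List.ofFn (fun i => r (label i)) = w then 1 else 0 := by
  have hsub : Subsingleton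
      {r : V → ℕ+ // OrderCondition r ∧ List.ofFn (fun i => r (label i)) = w} := by
    refine ⟨fun r s => Subtype.ext (funext fun v => ?_)⟩
    have h := List.ofFn_injective (r.2.2.trans s.2.2.symm)
    simpa using congrFun h (label.symm v)
  unfold F formalSum
  split_ifs with h
  · obtain ⟨r, hr⟩ := h
    have : Nonempty {r : V → ℕ+ // OrderCondition r ∧ List.ofFn (fun i => r (label i)) = w} :=
      ⟨⟨r, hr⟩⟩
    exact_mod_cast Nat.card_unique
  · have : IsEmpty {r : V → ℕ+ // OrderCondition r ∧ List.ofFn (fun i => r (label i)) = w} :=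
      ⟨fun r => h ⟨r.1, r.2⟩⟩
    exact_mod_cast Nat.card_of_isEmpty

theorem orderCondition_congr {V : Type*} [PartialOrder V] {r s : V → ℕ+}
    (h : ∀ x y, r x < r y ↔ s x < s y) : OrderCondition r ↔ OrderCondition s := by
  refine and_congr ⟨fun hr x y hxy => ?_, fun hr x y hxy => ?_⟩ ?_
  · exact not_lt.mp fun hlt => not_lt.mpr (hr hxy) ((h y x).2 hlt)
  · exact not_lt.mp fun hlt => not_lt.mpr (hr hxy) ((h y x).1 hlt)
  · simp only [h]

theorem exists_pack_iff {V : Type*} [PartialOrder V] {n : ℕ} (label : Fin n ≃ V) (w : List ℕ+) :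
    (∃ r : V → ℕ+, OrderCondition r ∧ List.ofFn (fun i => r (label i)) = pack w) ↔
      ∃ r : V → ℕ+, OrderCondition r ∧ List.ofFn (fun i => r (label i)) = w := by
  classical
  by_cases hn : w.length = n
  · subst hn
    have hw : ∃ s : V → ℕ+, List.ofFn (fun i => s (label i)) = w :=
      ⟨fun v => w.get (label.symm v), by simp⟩
    obtain ⟨s, hs⟩ := hw
    have hp : List.ofFn (fun i =>
        Nat.succPNat (w.toFinset.filter (fun c => c < s (label i))).card) = pack w := by
      conv_rhs => unfold pack
      conv_rhs => enter [2]; rw [← hs]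
      rw [List.map_ofFn]; rfl
    have hmem : ∀ v, s v ∈ w.toFinset := by
      intro v
      rw [List.mem_toFinset, ← hs, List.mem_ofFn]
      exact ⟨label.symm v, by simp⟩
    have key := orderCondition_congr (r := s)
      (s := fun v => Nat.succPNat (w.toFinset.filter (fun c => c < s v)).card) (by
        intro x y
        rw [← rank_lt_iff w.toFinset (c := s y) (hmem x), ← PNat.coe_lt_coe (Nat.succPNat _),
          Nat.succPNat_coe, Nat.succPNat_coe]
        exact Nat.succ_lt_succ_iff.symm)
    have huniq : ∀ r t : V → ℕ+, List.ofFn (fun i => r (label i)) =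
        List.ofFn (fun i => t (label i)) → r = t := by
      intro r t h
      funext v
      simpa using congrFun (List.ofFn_injective h) (label.symm v)
    constructor
    · rintro ⟨r, hr, hrw⟩
      rw [huniq r (fun v => Nat.succPNat (w.toFinset.filter (fun c => c < s v)).card)
        (hrw.trans hp.symm)] at hr
      exact ⟨s, key.2 hr, hs⟩
    · rintro ⟨r, hr, hrw⟩
      rw [huniq r _ (hrw.trans hs.symm)] at hr
      exact ⟨_, key.1 hr, hp⟩
  · constructor
    · rintro ⟨r, -, h⟩
      have := congrArg List.length h
      rw [List.length_ofFn, pack_length] at this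
      exact absurd this.symm hn
    · rintro ⟨r, -, h⟩
      have := congrArg List.length h
      rw [List.length_ofFn] at this
      exact absurd this.symm hn

/-- There are finitely many packed words of each length. -/
theorem packed_bounded (n : ℕ) :
    {u : PackedWord | u.1.length = n}.Finite := by
  classical
  refine Set.Finite.of_finite_image (f := Subtype.val) ?_ Subtype.val_injective.injOn
  have hfin : (Set.range fun g : Fin n → Fin n =>
      List.ofFn fun i => Nat.succPNat (g i).1).Finite := Set.finite_range _
  refine hfin.subset ?_
  rintro _ ⟨⟨u, hu⟩, hl, rfl⟩
  simp only [Set.mem_ofPred_eq] at hl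
  subst hl
  refine ⟨fun i => ⟨(u.toFinset.filter (fun c => c < u.get i)).card, ?_⟩, ?_⟩
  · refine lt_of_lt_of_le (Finset.card_lt_card ⟨Finset.filter_subset _ _, fun h => ?_⟩)
      u.toFinset_card_le
    have := h (List.mem_toFinset.mpr (u.get_mem i))
    simp at this
  · refine Eq.trans ?_ hu
    conv_rhs => unfold pack
    conv_rhs => enter [2]; rw [← List.ofFn_get u]
    rw [List.map_ofFn]; rfl

theorem F_mem_WQSym {V : Type*} [PartialOrder V] {n : ℕ} (label : Fin n ≃ V) :
    F label ∈ WQSym := by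
  classical
  have hF : F label = ∑ u ∈ (packed_bounded n).toFinset, F label u.1 • M u := by
    funext w
    simp only [Finset.sum_apply, Pi.smul_apply, M, smul_eq_mul, mul_ite, mul_one, mul_zero]
    by_cases hw : w.length = n
    · rw [Finset.sum_eq_single (⟨pack w, pack_pack w⟩ : PackedWord)]
      · rw [if_pos rfl, F_apply, F_apply]
        simp only [exists_pack_iff]
      · intro v _ hv
        exact if_neg fun h => hv (Subtype.ext h.symm)
      · intro h
        refine absurd ?_ h
        simp [pack_length, hw]
    · rw [Finset.sum_eq_zero, F_apply, if_neg]
      · rintro ⟨r, -, h⟩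
        exact hw (by rw [← h, List.length_ofFn])
      · intro u hu
        refine if_neg fun h => hw ?_
        rw [Set.Finite.mem_toFinset, Set.mem_ofPred_eq] at hu
        rw [← pack_length, h, hu]
  rw [hF]
  exact Submodule.sum_mem _ fun u _ =>
    Submodule.smul_mem _ _ (Submodule.subset_span ⟨u, rfl⟩)

/-- The word quasi-symmetric function `F_P`, as an element of `WQSym`. -/
noncomputable def FW {V : Type*} [PartialOrder V] {n : ℕ} (label : Fin n ≃ V) : WQSym :=
  ⟨F label, F_mem_WQSym label⟩

end NCPartition

/-!
Both sides are expanded as combinations of the products `a_{g(1)} ⋯ a_{g(n)}` over the functions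
`g` from the poset to the positions `1, …, 2m+1`, and the coefficients are compared.

On the side of `N_P`, the truncated variables are `b_i = a_{2i-1} - a_{2i}` and
`d_i = a_{2i} - a_{2i+1}`. So `g` determines the function `r` it comes from, namely
`r(v) = ⌈g(v)/2⌉` at even height and `r(v) = ⌊g(v)/2⌋` at odd height. In a ranked poset the parity
of the height alternates along the covering relations, and the order condition for `r` then turns
into the level condition for `g`: along a cover `x ⋖ y` one has `g x ≤ g y`, and equality is only
allowed at an odd position if `x` has odd height and at an even position if `x` has even height
(`orderCondition_iff_levelCondition`). The coefficient is thus `(-1)^{|V₀|} (-1)^{#{g odd}}` or `0`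
(`sum_prod_diffCoeff`).

On the side of `F_P(𝔸_m)`, the coefficient of `g` is a signed count of the ordered set partitions
of the poset which satisfy the order condition and refine the partition into the levels of `g`.
It is computed by splitting off the lowest block `U` (`sum_admissible_eq`). If the
lowest level has sign `⊕`, then `U` is that level. If it has sign `⊖`, then by induction it is
enough to see that the sum over all the possible `U`, including the empty set, is zero. Here
the alternation of parities makes the conditions on `U` elementwise: elements of even height on an
edge inside the level are forced into or out of `U`, those of odd height are free; if the
level has none of odd height, there are no such edges and every element is free. Adding or removing
a free element is the required sign-reversing involution (`toggle_iff`,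
`sum_bottomBlock_minus`). The coefficient is `(-1)^{#{g odd}}` under the level condition and `0`
otherwise (`sum_weight`).
-/

namespace NCPartition

/-! ### Signed counting of ordered set partitions -/

section Core

variable {ι : Type*} {N : ℕ}

/-- A function `r` is packed on `Q` if it vanishes exactly outside `Q` and takes on `Q` precisely
the values `1, …, k` for some `k`. Such functions encode the ordered set partitions of `Q`. -/
def IsPackedOn (Q : Finset ι) (r : ι → ℕ) : Prop :=
  (∀ v, r v = 0 ↔ v ∉ Q) ∧ ∀ v j, 0 < j → j ≤ r v → ∃ w, r w = j

/-- The order condition read off a relation `e` (later the covering relation): along an edge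
within `Q` the function weakly increases, and strictly if the edge starts in `p`
(later the elements of odd height). -/
def EdgeCondition (e : ι → ι → Prop) (p : ι → Prop) (Q : Finset ι) (r : ι → ℕ) : Prop :=
  ∀ x ∈ Q, ∀ y ∈ Q, e x y → r x ≤ r y ∧ (p x → r x < r y)

/-- The packed functions on `Q` which satisfy the order condition and through which
`g` factors as a weakly increasing map. -/
def IsAdmissible (e : ι → ι → Prop) (p : ι → Prop) (g : ι → Fin N) (Q : Finset ι)
    (r : ι → ℕ) : Prop :=
  IsPackedOn Q r ∧ EdgeCondition e p Q r ∧ ∀ x ∈ Q, ∀ y ∈ Q, r x ≤ r y → g x ≤ g y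

/-- The product of the multiplicities with which the values taken by `r` on `Q` are sent
to the signed letters, when the value `r v` is sent to the position `g v`. -/
def weight (σ : Fin N → Sign) (g : ι → Fin N) (Q : Finset ι) (r : ι → ℕ) : ℤ :=
  ∏ j, (σ j).mult ((Q.filter (g · = j)).image r).card

theorem IsPackedOn.le_card [DecidableEq ι] {Q : Finset ι} {r : ι → ℕ} (h : IsPackedOn Q r) (v : ι) :
    r v ≤ Q.card := by
  have hsub : Finset.Icc 1 (r v) ⊆ Q.image r := by
    intro j hj
    rw [Finset.mem_Icc] at hj
    obtain ⟨w, hw⟩ := h.2 v j (by omega) hj.2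
    refine Finset.mem_image.2 ⟨w, ?_, hw⟩
    by_contra hwQ
    have := (h.1 w).2 hwQ
    omega
  have := (Finset.card_le_card hsub).trans Finset.card_image_le
  simpa using this

open Classical in
/-- The finite set of admissible functions; the bound on the values only serves finiteness. -/
noncomputable def admissible [Fintype ι] (e : ι → ι → Prop) (p : ι → Prop) (g : ι → Fin N)
    (Q : Finset ι) : Finset (ι → ℕ) :=
  (Fintype.piFinset fun _ => Finset.range (Q.card + 1)).filter (IsAdmissible e p g Q)

theorem mem_admissible [Fintype ι] {e : ι → ι → Prop} {p : ι → Prop} {g : ι → Fin N}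
    {Q : Finset ι} {r : ι → ℕ} : r ∈ admissible e p g Q ↔ IsAdmissible e p g Q r := by
  classical
  simp only [admissible, Finset.mem_filter, Fintype.mem_piFinset, Finset.mem_range,
    and_iff_right_iff_imp]
  exact fun h v => Nat.lt_succ_of_le (h.1.le_card v)

/-- Along an edge within `Q` the function `g` weakly increases, and it can be constant only at a
level of sign `⊖` if the edge starts in `p`, and only at one of sign `⊕` otherwise. For
the sign `⊕` this is the order condition, for `⊖` the opposite one. -/
def LevelCondition (e : ι → ι → Prop) (p : ι → Prop) (σ : Fin N → Sign) (g : ι → Fin N)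
    (Q : Finset ι) : Prop :=
  ∀ x ∈ Q, ∀ y ∈ Q, e x y → g x ≤ g y ∧ (g x = g y → (σ (g x) = Sign.minus ↔ p x))

/-- The condition for `U` to be the set where an admissible function on `Q` is equal to `1`. -/
def IsBottomBlock (e : ι → ι → Prop) (p : ι → Prop) (Q U : Finset ι) : Prop :=
  ∀ x ∈ Q, ∀ y ∈ Q, e x y → y ∈ U → x ∈ U ∧ ¬ p x

/-- The ordered set partition obtained from `r`, which is packed on a subset of `Q`, by adding the
rest of `Q` as a new lowest block. -/
def lift [DecidableEq ι] (Q : Finset ι) (r : ι → ℕ) : ι → ℕ :=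
  fun v => if v ∈ Q then r v + 1 else 0

variable {e : ι → ι → Prop} {p : ι → Prop} {σ : Fin N → Sign} {g : ι → Fin N} {Q U : Finset ι}
  {j₀ : Fin N}

theorem isAdmissible_lift [DecidableEq ι] {r : ι → ℕ} (hmin : ∀ v ∈ Q, j₀ ≤ g v)
    (hU : U ⊆ Q.filter (g · = j₀)) (hne : U.Nonempty) (hb : IsBottomBlock e p Q U)
    (hr : IsAdmissible e p g (Q \ U) r) : IsAdmissible e p g Q (lift Q r) := by
  have hr0 : ∀ v, r v = 0 ↔ (v ∈ Q → v ∈ U) := by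
    intro v; rw [hr.1.1 v]; simp
  have hUQ : ∀ v ∈ U, v ∈ Q := fun v hv => (Finset.mem_filter.1 (hU hv)).1
  have hUg : ∀ v ∈ U, g v = j₀ := fun v hv => (Finset.mem_filter.1 (hU hv)).2
  refine ⟨⟨fun v => ?_, fun v j hj hjv => ?_⟩, ?_, ?_⟩
  · simp [lift]
  · have hv : v ∈ Q := by
      by_contra h
      simp [lift, h] at hjv; omega
    simp only [lift, hv, if_true] at hjv
    rcases Nat.eq_or_lt_of_le hj with h1 | h1
    · obtain ⟨u, hu⟩ := hne
      refine ⟨u, ?_⟩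
      simp [lift, hUQ u hu, (hr0 u).2 fun _ => hu, ← h1]
    · obtain ⟨w, hw⟩ := hr.1.2 v (j - 1) (by omega) (by omega)
      have hwQ : w ∈ Q := by
        by_contra h
        have := (hr0 w).2 fun h' => absurd h' h
        omega
      exact ⟨w, by simp [lift, hwQ, hw]; omega⟩
  · intro x hx y hy hxy
    simp only [lift, hx, hy, if_true]
    have hbb := hb x hx y hy hxy
    by_cases hyU : y ∈ U
    · have h1 := hbb hyU
      have h2 := (hr0 x).2 fun _ => h1.1
      exact ⟨by omega, fun h => absurd h h1.2⟩
    · have hy0 : r y ≠ 0 := fun h => hyU ((hr0 y).1 h hy)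
      by_cases hxU : x ∈ U
      · have h2 := (hr0 x).2 fun _ => hxU
        omega
      · have := hr.2.1 x (by simp [hx, hxU]) y (by simp [hy, hyU]) hxy
        exact ⟨by omega, fun h => by have := this.2 h; omega⟩
  · intro x hx y hy hxy
    simp only [lift, hx, hy, if_true] at hxy
    by_cases hxU : x ∈ U
    · rw [hUg x hxU]; exact hmin y hy
    · have hx0 : r x ≠ 0 := fun h => hxU ((hr0 x).1 h hx)
      have hyU : y ∉ U := fun h => by
        have := (hr0 y).2 fun _ => h
        omega
      exact hr.2.2 x (by simp [hx, hxU]) y (by simp [hy, hyU]) (by omega)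

theorem IsAdmissible.exists_one {r : ι → ℕ} (hr : IsAdmissible e p g Q r) (hQ : Q.Nonempty) :
    ∃ v ∈ Q, r v = 1 := by
  obtain ⟨v, hv⟩ := hQ
  have : r v ≠ 0 := fun h => (hr.1.1 v).1 h hv
  obtain ⟨w, hw⟩ := hr.1.2 v 1 one_pos (by omega)
  refine ⟨w, ?_, hw⟩
  by_contra h
  have := (hr.1.1 w).2 h
  omega

theorem IsAdmissible.isBottomBlock {r : ι → ℕ} (hr : IsAdmissible e p g Q r) :
    IsBottomBlock e p Q (Q.filter (r · = 1)) := by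
  intro x hx y hy hxy hyU
  have h1 := hr.2.1 x hx y hy hxy
  have hx0 : r x ≠ 0 := fun h => (hr.1.1 x).1 h hx
  simp only [Finset.mem_filter, hx, true_and, hy] at hyU ⊢
  exact ⟨by omega, fun h => by have := h1.2 h; omega⟩

theorem IsAdmissible.filter_one_subset {r : ι → ℕ} (hr : IsAdmissible e p g Q r)
    (hmin : ∀ v ∈ Q, j₀ ≤ g v) (hex : ∃ v ∈ Q, g v = j₀) :
    Q.filter (r · = 1) ⊆ Q.filter (g · = j₀) := by
  intro x hx
  obtain ⟨hx, hx1⟩ := Finset.mem_filter.1 hx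
  obtain ⟨v, hv, hvj⟩ := hex
  refine Finset.mem_filter.2 ⟨hx, le_antisymm ?_ (hmin x hx)⟩
  have hv0 : r v ≠ 0 := fun h => (hr.1.1 v).1 h hv
  exact (hr.2.2 x hx v hv (by omega)).trans_eq hvj

theorem IsAdmissible.pred [DecidableEq ι] {r : ι → ℕ} (hr : IsAdmissible e p g Q r) :
    IsAdmissible e p g (Q \ Q.filter (r · = 1)) (fun v => r v - 1) := by
  have h0 := hr.1.1
  have hmem : ∀ v, v ∈ Q \ Q.filter (r · = 1) ↔ 2 ≤ r v := by
    intro v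
    have := h0 v
    simp only [Finset.mem_sdiff, Finset.mem_filter]
    by_cases hv : v ∈ Q
    · simp only [hv, not_true, iff_false] at this ⊢; simp; omega
    · simp only [hv, not_false_iff, iff_true] at this ⊢; simp; omega
  have hQ : ∀ v, 2 ≤ r v → v ∈ Q := fun v hv => (Finset.mem_sdiff.1 ((hmem v).2 hv)).1
  refine ⟨⟨fun v => ?_, fun v j hj hjv => ?_⟩, ?_, ?_⟩
  · rw [hmem]; dsimp only; omega
  · dsimp only at hjv
    obtain ⟨w, hw⟩ := hr.1.2 v (j + 1) (by omega) (by omega)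
    exact ⟨w, by dsimp only; omega⟩
  · intro x hx y hy hxy
    rw [hmem] at hx hy
    have := hr.2.1 x (hQ x hx) y (hQ y hy) hxy
    dsimp only
    exact ⟨by omega, fun h => by have := this.2 h; omega⟩
  · intro x hx y hy hxy
    rw [hmem] at hx hy
    dsimp only at hxy
    exact hr.2.2 x (hQ x hx) y (hQ y hy) (by omega)

open Classical in
/-- Splitting off the lowest block of an ordered set partition. -/
theorem sum_admissible_eq [Fintype ι] [DecidableEq ι] {β : Type*} [AddCommMonoid β]
    (φ : (ι → ℕ) → β)
    (hmin : ∀ v ∈ Q, j₀ ≤ g v) (hex : ∃ v ∈ Q, g v = j₀) :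
    ∑ r ∈ admissible e p g Q, φ r =
      ∑ U ∈ (Q.filter (g · = j₀)).powerset.filter (fun U => U.Nonempty ∧ IsBottomBlock e p Q U),
        ∑ r ∈ admissible e p g (Q \ U), φ (lift Q r) := by
  rw [Finset.sum_sigma']
  refine Finset.sum_bij' (fun r _ => ⟨Q.filter (r · = 1), fun v => r v - 1⟩)
    (fun a _ => lift Q a.2) ?_ ?_ ?_ ?_ ?_
  · intro r hr
    rw [mem_admissible] at hr
    obtain ⟨v, hv, hv1⟩ := hr.exists_one (hex.imp fun _ h => h.1)
    simp only [Finset.mem_sigma, Finset.mem_filter, Finset.mem_powerset]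
    exact ⟨⟨hr.filter_one_subset hmin hex, ⟨v, by simp [hv, hv1]⟩, hr.isBottomBlock⟩,
      mem_admissible.2 hr.pred⟩
  · rintro ⟨U, r⟩ h
    simp only [Finset.mem_sigma, Finset.mem_filter, Finset.mem_powerset, mem_admissible] at h ⊢
    exact isAdmissible_lift hmin h.1.1 h.1.2.1 h.1.2.2 h.2
  · intro r hr
    rw [mem_admissible] at hr
    funext v
    have := hr.1.1 v
    simp only [lift]
    split_ifs with hv
    · simp only [hv, not_true, iff_false] at this; omega
    · exact (this.2 hv).symm
  · rintro ⟨U, r⟩ h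
    simp only [Finset.mem_sigma, Finset.mem_filter, Finset.mem_powerset, mem_admissible] at h
    have hr0 := h.2.1.1
    have e1 : Q.filter (lift Q r · = 1) = U := by
      ext v
      have := hr0 v
      have hUQ : v ∈ U → v ∈ Q := fun hv => (Finset.mem_filter.1 (h.1.1 hv)).1
      rw [Finset.mem_filter]
      by_cases hv : v ∈ Q
      · simp only [hv, true_and, Finset.mem_sdiff, not_not] at this
        rw [← this, lift, if_pos hv]
        simp [hv]
      · exact ⟨fun h => absurd h.1 hv, fun h => absurd (hUQ h) hv⟩
    have e2 : (fun v => lift Q r v - 1) = r := by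
      funext v
      have := hr0 v
      simp only [lift]
      split_ifs with hv
      · rfl
      · exact (this.2 (by simp [hv])).symm
    simp only [e1, e2]
  · intro r hr
    congr 1
    rw [mem_admissible] at hr
    funext v
    have := hr.1.1 v
    simp only [lift]
    split_ifs with hv
    · simp only [hv, not_true, iff_false] at this; omega
    · exact this.2 hv

theorem card_image_lift [DecidableEq ι] {r : ι → ℕ}
    (hU : U ⊆ Q.filter (g · = j₀)) (hne : U.Nonempty) (hr : IsPackedOn (Q \ U) r) (j : Fin N) :
    ((Q.filter (g · = j)).image (lift Q r)).card =
      (((Q \ U).filter (g · = j)).image r).card + if j = j₀ then 1 else 0 := by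
  have hr0 : ∀ v ∈ Q \ U, r v ≠ 0 := fun v hv h => (hr.1 v).1 h hv
  have hU0 : ∀ v ∈ U, r v = 0 := fun v hv => (hr.1 v).2 (by simp [hv])
  have hUQ : ∀ v ∈ U, v ∈ Q := fun v hv => (Finset.mem_filter.1 (hU hv)).1
  have hUg : ∀ v ∈ U, g v = j₀ := fun v hv => (Finset.mem_filter.1 (hU hv)).2
  have hinj : Function.Injective Nat.succ := Nat.succ_injective
  rw [← Finset.card_image_of_injective (((Q \ U).filter (g · = j)).image r) hinj]
  split_ifs with hj
  · rw [← Finset.card_insert_of_notMem (a := 1)]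
    · congr 1
      ext k
      simp only [Finset.mem_image, Finset.mem_filter, Finset.mem_insert, Finset.mem_sdiff, lift]
      constructor
      · rintro ⟨v, ⟨hv, hgv⟩, rfl⟩
        by_cases hvU : v ∈ U
        · left; simp [hv, hU0 v hvU]
        · right; exact ⟨_, ⟨v, ⟨⟨hv, hvU⟩, hgv⟩, rfl⟩, by simp [hv]⟩
      · rintro (rfl | ⟨_, ⟨v, ⟨⟨hv, hvU⟩, hgv⟩, rfl⟩, rfl⟩)
        · obtain ⟨u, hu⟩ := hne
          exact ⟨u, ⟨hUQ u hu, (hUg u hu).trans hj.symm⟩, by simp [hUQ u hu, hU0 u hu]⟩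
        · exact ⟨v, ⟨hv, hgv⟩, by simp [hv]⟩
    · simp only [Finset.mem_image, Finset.mem_filter]
      rintro ⟨_, ⟨v, ⟨hv, -⟩, rfl⟩, h⟩
      exact hr0 v hv (by simpa using h)
  · rw [add_zero]
    congr 1
    ext k
    simp only [Finset.mem_image, Finset.mem_filter, Finset.mem_sdiff, lift]
    constructor
    · rintro ⟨v, ⟨hv, hgv⟩, rfl⟩
      have hvU : v ∉ U := fun h => hj (hgv.symm.trans (hUg v h))
      exact ⟨_, ⟨v, ⟨⟨hv, hvU⟩, hgv⟩, rfl⟩, by simp [hv]⟩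
    · rintro ⟨_, ⟨v, ⟨⟨hv, hvU⟩, hgv⟩, rfl⟩, rfl⟩
      exact ⟨v, ⟨hv, hgv⟩, by simp [hv]⟩

/-- A new block in a level of sign `⊖` changes `(-1) ^ k` to `(-1) ^ (k + 1)`. -/
theorem weight_lift_minus [DecidableEq ι] {r : ι → ℕ}
    (hU : U ⊆ Q.filter (g · = j₀)) (hne : U.Nonempty) (hr : IsPackedOn (Q \ U) r)
    (hσ : σ j₀ = Sign.minus) :
    weight σ g Q (lift Q r) = - weight σ g (Q \ U) r := by
  unfold weight
  simp only [card_image_lift hU hne hr]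
  rw [← Finset.mul_prod_erase _ _ (Finset.mem_univ j₀), ← Finset.mul_prod_erase _ _
    (Finset.mem_univ j₀), if_pos rfl, hσ, ← neg_mul]
  congr 1
  · simp [Sign.mult, pow_succ]
  · refine Finset.prod_congr rfl fun j hj => ?_
    rw [if_neg (Finset.ne_of_mem_erase hj), add_zero]

/-- A level of sign `⊕` consists of at most one block, so a new block has to be the whole level. -/
theorem weight_lift_plus [DecidableEq ι] {r : ι → ℕ}
    (hU : U ⊆ Q.filter (g · = j₀)) (hne : U.Nonempty) (hr : IsPackedOn (Q \ U) r)
    (hσ : σ j₀ = Sign.plus) :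
    weight σ g Q (lift Q r) =
      if U = Q.filter (g · = j₀) then weight σ g (Q \ U) r else 0 := by
  have hcond : (((Q \ U).filter (g · = j₀)).image r).card = 0 ↔ U = Q.filter (g · = j₀) := by
    rw [Finset.card_eq_zero, Finset.image_eq_empty]
    constructor
    · intro h
      refine Finset.Subset.antisymm hU fun v hv => ?_
      by_contra hvU
      have : v ∈ (Q \ U).filter (g · = j₀) := by
        simp only [Finset.mem_filter, Finset.mem_sdiff] at hv ⊢
        exact ⟨⟨hv.1, hvU⟩, hv.2⟩
      rw [h] at this
      simp at this
    · rintro h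
      ext v
      rw [h]
      simp +contextual
  unfold weight
  simp only [card_image_lift hU hne hr]
  rw [← Finset.mul_prod_erase _ _ (Finset.mem_univ j₀), ← Finset.mul_prod_erase _ _
    (Finset.mem_univ j₀), if_pos rfl, hσ]
  split_ifs with h
  · rw [hcond.2 h]
    congr 1
    refine Finset.prod_congr rfl fun j hj => ?_
    rw [if_neg (Finset.ne_of_mem_erase hj), add_zero]
  · have : ¬ ((((Q \ U).filter (g · = j₀)).image r).card + 1 ≤ 1) := by
      rw [← hcond] at h; omega
    simp [Sign.mult, this]

/-- In the lowest level, when it carries the sign `⊖`, adding or removing the element `z` preserves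
the conditions on a lowest block `U` and on its complement. An edge inside this level forces its
endpoint outside `p` into `U` (if it is the start) or out of `U` (if it is the end) and leaves the
endpoint in `p` free. So any element of `p` will do for `z`; without elements of `p`
there are no edges inside the level, and every element is free. -/
theorem toggle_iff [DecidableEq ι] (he : ∀ x y, e x y → (p x ↔ ¬ p y)) (hmin : ∀ v ∈ Q, j₀ ≤ g v)
    (hσ : σ j₀ = Sign.minus) {z : ι} (hz : z ∈ Q) (hzg : g z = j₀)
    (hzp : p z ∨ ∀ v ∈ Q, g v = j₀ → ¬ p v) (hU : U ⊆ Q.filter (g · = j₀)) (hzU : z ∉ U) :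
    (IsBottomBlock e p Q (insert z U) ∧ LevelCondition e p σ g (Q \ insert z U)) ↔
      (IsBottomBlock e p Q U ∧ LevelCondition e p σ g (Q \ U)) := by
  have hUg : ∀ v ∈ U, g v = j₀ := fun v hv => (Finset.mem_filter.1 (hU hv)).2
  have key : ∀ U' : Finset ι, (IsBottomBlock e p Q U' ∧ LevelCondition e p σ g (Q \ U')) ↔
      ∀ x ∈ Q, ∀ y ∈ Q, e x y → (y ∈ U' → x ∈ U' ∧ ¬ p x) ∧
        (x ∉ U' → y ∉ U' → g x ≤ g y ∧ (g x = g y → (σ (g x) = Sign.minus ↔ p x))) := by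
    intro U'
    simp only [IsBottomBlock, LevelCondition, Finset.mem_sdiff]
    constructor
    · rintro ⟨h1, h2⟩ x hx y hy hxy
      exact ⟨h1 x hx y hy hxy, fun hx' hy' => h2 x ⟨hx, hx'⟩ y ⟨hy, hy'⟩ hxy⟩
    · intro h
      exact ⟨fun x hx y hy hxy => (h x hx y hy hxy).1,
        fun x hx y hy hxy => (h x hx.1 y hy.1 hxy).2 hx.2 hy.2⟩
  rw [key, key]
  refine forall₂_congr fun x hx => forall₂_congr fun y hy => forall_congr' fun hxy => ?_
  have hpxy := he x y hxy
  have hx' := hmin x hx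
  have hy' := hmin y hy
  by_cases hxz : x = z <;> by_cases hyz : y = z
  · subst hxz; subst hyz; exact absurd hpxy (by tauto)
  · subst hxz
    simp only [Finset.mem_insert, hyz, hzU, hzg, hσ, false_or]
    rcases hzp with h | h
    · tauto
    · have h3 := h x hx hzg
      have h4 : g y ≠ j₀ := fun h' => absurd (h y hy h') (by tauto)
      have h5 : y ∉ U := fun h => h4 (hUg y h)
      have h6 : j₀ ≠ g y := h4.symm
      tauto
  · subst hyz
    simp only [Finset.mem_insert, hxz, hzU, hzg, false_or]
    have h0 : g x ≤ j₀ → g x = j₀ := fun h => le_antisymm h hx'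
    rcases hzp with h | h
    · by_cases hxU : x ∈ U
      · tauto
      · have : ¬ (g x ≤ j₀ ∧ (g x = j₀ → (σ (g x) = Sign.minus ↔ p x))) := by
          rintro ⟨h1, h2⟩
          have h3 := h0 h1
          have := h2 h3
          rw [h3, hσ] at this
          tauto
        tauto
    · have h3 := h y hy hzg
      have h4 : g x ≠ j₀ := fun h' => absurd (h x hx h') (by tauto)
      have h5 : x ∉ U := fun h => h4 (hUg x h)
      tauto
  · simp only [Finset.mem_insert, hxz, hyz, false_or]

/-- When the lowest level carries the sign `⊕`, only the whole level can be the lowest block; this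
says that removing it is compatible with the level condition. -/
theorem levelCondition_iff_of_plus [DecidableEq ι]
    (hmin : ∀ v ∈ Q, j₀ ≤ g v) (hσ : σ j₀ = Sign.plus) :
    LevelCondition e p σ g Q ↔ IsBottomBlock e p Q (Q.filter (g · = j₀)) ∧
      LevelCondition e p σ g (Q \ Q.filter (g · = j₀)) := by
  constructor
  · intro h
    refine ⟨fun x hx y hy hxy hyU => ?_, fun x hx y hy hxy => ?_⟩
    · have hyj := (Finset.mem_filter.1 hyU).2
      have h1 := h x hx y hy hxy
      have hxj : g x = j₀ := le_antisymm (hyj ▸ h1.1) (hmin x hx)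
      refine ⟨Finset.mem_filter.2 ⟨hx, hxj⟩, fun hp => ?_⟩
      have := (h1.2 (hxj.trans hyj.symm)).2 hp
      rw [hxj, hσ] at this
      cases this
    · exact h x (Finset.mem_sdiff.1 hx).1 y (Finset.mem_sdiff.1 hy).1 hxy
  · rintro ⟨h1, h2⟩ x hx y hy hxy
    by_cases hyj : g y = j₀
    · obtain ⟨hxU, hp⟩ := h1 x hx y hy hxy (Finset.mem_filter.2 ⟨hy, hyj⟩)
      have hxj := (Finset.mem_filter.1 hxU).2
      rw [hxj, hyj, hσ]
      exact ⟨le_rfl, fun _ => ⟨fun h => by injection h, fun h => absurd h hp⟩⟩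
    · by_cases hxj : g x = j₀
      · rw [hxj]
        exact ⟨hmin y hy, fun h => absurd h.symm hyj⟩
      · exact h2 x (by simp [hx, hxj]) y (by simp [hy, hyj]) hxy

open Classical in
/-- The involution `U ↔ U ∪ {z}` cancels the terms of the recursion at a level of sign `⊖`,
including the term of `U = ∅`. -/
theorem sum_bottomBlock_minus (he : ∀ x y, e x y → (p x ↔ ¬ p y)) (hmin : ∀ v ∈ Q, j₀ ≤ g v)
    (hex : ∃ v ∈ Q, g v = j₀) (hσ : σ j₀ = Sign.minus) :
    ∑ U ∈ (Q.filter (g · = j₀)).powerset,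
      (if IsBottomBlock e p Q U ∧ LevelCondition e p σ g (Q \ U) then
        (-1 : ℤ) ^ ((Q \ U).filter (fun v => σ (g v) = Sign.minus)).card else 0) = 0 := by
  obtain ⟨z, hz, hzg, hzp⟩ : ∃ z ∈ Q, g z = j₀ ∧ (p z ∨ ∀ v ∈ Q, g v = j₀ → ¬ p v) := by
    by_cases h : ∃ v ∈ Q, g v = j₀ ∧ p v
    · obtain ⟨v, h1, h2, h3⟩ := h
      exact ⟨v, h1, h2, Or.inl h3⟩
    · push Not at h
      obtain ⟨v, h1, h2⟩ := hex
      exact ⟨v, h1, h2, Or.inr h⟩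
  have hzL : z ∈ Q.filter (g · = j₀) := Finset.mem_filter.2 ⟨hz, hzg⟩
  rw [← Finset.insert_erase hzL, Finset.sum_powerset_insert (Finset.notMem_erase _ _),
    ← Finset.sum_add_distrib]
  refine Finset.sum_eq_zero fun U hU => ?_
  rw [Finset.mem_powerset] at hU
  have hzU : z ∉ U := fun h => Finset.notMem_erase _ _ (hU h)
  have hUL := hU.trans (Finset.erase_subset _ _)
  rw [if_congr (toggle_iff he hmin hσ hz hzg hzp hUL hzU) rfl rfl]
  split_ifs
  · have : (Q \ U).filter (fun v => σ (g v) = Sign.minus) =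
        insert z ((Q \ insert z U).filter (fun v => σ (g v) = Sign.minus)) := by
      ext v
      by_cases hv : v = z
      · subst hv; simp [hz, hzU, hzg, hσ]
      · simp [hv]
    rw [this, Finset.card_insert_of_notMem (by simp), pow_succ]
    ring
  · simp

open Classical in
/-- A form of reciprocity for the order condition, over all levels at once. With `Q` the
whole poset, the left-hand side is the coefficient of the word `g` in the evaluation of `F_P` on a
virtual alphabet. -/
theorem sum_weight [Fintype ι] (he : ∀ x y, e x y → (p x ↔ ¬ p y)) (Q : Finset ι) :
    ∑ r ∈ admissible e p g Q, weight σ g Q r =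
      if LevelCondition e p σ g Q then
        (-1 : ℤ) ^ (Q.filter (fun v => σ (g v) = Sign.minus)).card else 0 := by
  induction Q using Finset.strongInduction with
  | H Q ih =>
  rcases Q.eq_empty_or_nonempty with rfl | hQ
  · have : admissible e p g ∅ = {fun _ => 0} := by
      ext r
      rw [mem_admissible, Finset.mem_singleton]
      constructor
      · exact fun h => funext fun v => (h.1.1 v).2 (by simp)
      · rintro rfl
        refine ⟨⟨by simp, ?_⟩, ?_, ?_⟩
        · intro v j h1 h2; simp at h2; omega
        · intro x hx; simp at hx
        · intro x hx; simp at hx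
    have h0 : LevelCondition e p σ g ∅ := fun x hx => by simp at hx
    rw [this, if_pos h0]
    simp only [Finset.sum_singleton, weight, Finset.filter_empty, Finset.image_empty,
      Finset.card_empty, pow_zero]
    refine Finset.prod_eq_one fun j _ => ?_
    cases σ j <;> simp [Sign.mult]
  obtain ⟨q, hq, hqmin⟩ := Q.exists_min_image g hQ
  obtain ⟨j₀, hj₀⟩ : ∃ j₀, j₀ = g q := ⟨_, rfl⟩
  have hmin : ∀ v ∈ Q, j₀ ≤ g v := fun v hv => hj₀ ▸ hqmin v hv
  have hex : ∃ v ∈ Q, g v = j₀ := ⟨q, hq, hj₀.symm⟩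
  have hss : ∀ U, U ⊆ Q.filter (g · = j₀) → U.Nonempty → Q \ U ⊂ Q := fun U hU hne =>
    Finset.sdiff_ssubset (hU.trans (Finset.filter_subset _ _)) hne
  rw [sum_admissible_eq _ hmin hex]
  cases hσ : σ j₀ with
  | minus =>
    have h0 := sum_bottomBlock_minus he hmin hex hσ
    have hcongr : ∀ U ∈ (Q.filter (g · = j₀)).powerset.filter
        (fun U => U.Nonempty ∧ IsBottomBlock e p Q U),
        ∑ r ∈ admissible e p g (Q \ U), weight σ g Q (lift Q r) =
        - (if IsBottomBlock e p Q U ∧ LevelCondition e p σ g (Q \ U) then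
          (-1 : ℤ) ^ ((Q \ U).filter (fun v => σ (g v) = Sign.minus)).card else 0) := by
      intro U hU
      simp only [Finset.mem_filter, Finset.mem_powerset] at hU
      rw [Finset.sum_congr rfl fun r hr =>
        weight_lift_minus hU.1 hU.2.1 (mem_admissible.1 hr).1 hσ, Finset.sum_neg_distrib,
        ih _ (hss U hU.1 hU.2.1)]
      simp [hU.2.2]
    rw [Finset.sum_congr rfl hcongr, Finset.sum_neg_distrib, neg_eq_iff_add_eq_zero]
    refine Eq.trans ?_ h0
    rw [← Finset.sum_erase_add _ _ (Finset.empty_mem_powerset (Q.filter (g · = j₀)))]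
    congr 1
    · refine Finset.sum_subset_zero_on_sdiff ?_ ?_ fun _ _ => rfl
      · intro U hU
        simp only [Finset.mem_filter, Finset.mem_erase] at hU ⊢
        exact ⟨hU.2.1.ne_empty, hU.1⟩
      · intro U hU
        simp only [Finset.mem_filter, Finset.mem_erase, Finset.mem_sdiff] at hU
        refine if_neg fun h => hU.2 ⟨hU.1.2, Finset.nonempty_iff_ne_empty.2 hU.1.1, h.1⟩
    · have : IsBottomBlock e p Q ∅ := fun x _ y _ _ h => by simp at h
      simp [this]
  | plus =>
    have hL : (Q.filter (g · = j₀)).Nonempty := ⟨q, by simp [hq, hj₀]⟩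
    have hcongr : ∀ U ∈ (Q.filter (g · = j₀)).powerset.filter
        (fun U => U.Nonempty ∧ IsBottomBlock e p Q U),
        ∑ r ∈ admissible e p g (Q \ U), weight σ g Q (lift Q r) =
        if U = Q.filter (g · = j₀) then (if LevelCondition e p σ g (Q \ U) then
          (-1 : ℤ) ^ ((Q \ U).filter (fun v => σ (g v) = Sign.minus)).card else 0) else 0 := by
      intro U hU
      simp only [Finset.mem_filter, Finset.mem_powerset] at hU
      rw [Finset.sum_congr rfl fun r hr =>
        weight_lift_plus hU.1 hU.2.1 (mem_admissible.1 hr).1 hσ]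
      split_ifs with h1 h2
      · rw [ih _ (hss U hU.1 hU.2.1), if_pos h2]
      · rw [ih _ (hss U hU.1 hU.2.1), if_neg h2]
      · simp
    rw [Finset.sum_congr rfl hcongr, Finset.sum_ite_eq']
    have hcard : (Q \ Q.filter (g · = j₀)).filter (fun v => σ (g v) = Sign.minus) =
        Q.filter (fun v => σ (g v) = Sign.minus) := by
      ext v
      simp only [Finset.mem_filter, Finset.mem_sdiff]
      constructor
      · exact fun h => ⟨h.1.1, h.2⟩
      · exact fun h => ⟨⟨h.1, fun h' => by rw [h'.2, hσ] at h; cases h.2⟩, h.2⟩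
    rw [hcard, if_congr (levelCondition_iff_of_plus hmin hσ) rfl rfl]
    simp only [Finset.mem_filter, Finset.mem_powerset, subset_refl, hL, true_and]
    split_ifs <;> tauto

end Core

/-! ### Evaluation of `F_P` on a virtual alphabet -/

section Evaluation

theorem orderCondition_iff_covBy {V : Type*} [PartialOrder V] [Finite V] {r : V → ℕ+} :
    OrderCondition r ↔ ∀ x y : V, x ⋖ y → r x ≤ r y ∧ (Odd (height x) → r x < r y) := by
  constructor
  · exact fun h x y hxy => ⟨h.1 hxy.le, h.2 x y hxy.lt⟩
  · intro h
    have hmono : Monotone r := by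
      intro x y hxy
      induction y using WellFoundedLT.induction with
      | ind y ih =>
      rcases hxy.eq_or_lt with rfl | hlt
      · exact le_rfl
      · obtain ⟨z, hxz, hzy⟩ := exists_le_covBy_of_lt hlt
        exact (ih z hzy.lt hxz).trans (h z y hzy).1
    refine ⟨hmono, fun x y hxy hx => ?_⟩
    obtain ⟨z, hxz, hzy⟩ := exists_covBy_le_of_lt hxy
    exact ((h x z hxz).2 hx).trans_le (hmono hzy)

theorem orderCondition_comp_symm_iff {V : Type*} [PartialOrder V] {n : ℕ} (label : Fin n ≃ V)
    (r : Fin n → ℕ+) : OrderCondition (fun v => r (label.symm v)) ↔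
      EdgeCondition (fun i j => label i ⋖ label j) (fun i => Odd (height (label i))) Finset.univ
        (fun i => (r i : ℕ)) := by
  have : Finite V := Finite.of_equiv _ label
  rw [orderCondition_iff_covBy]
  simp only [EdgeCondition, label.symm.forall_congr_left, Finset.mem_univ, forall_true_left,
    Equiv.symm_symm, Equiv.symm_apply_apply, PNat.coe_le_coe, PNat.coe_lt_coe]

theorem F_ofFn {V : Type*} [PartialOrder V] {n : ℕ} (label : Fin n ≃ V) (r : Fin n → ℕ+)
    [Decidable (OrderCondition fun v => r (label.symm v))] :
    F label (List.ofFn r) = if OrderCondition (fun v => r (label.symm v)) then 1 else 0 := by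
  classical
  rw [F_apply]
  refine if_congr ⟨?_, fun h => ⟨_, h, by simp⟩⟩ rfl rfl
  rintro ⟨s, hs, h⟩
  have : s = fun v => r (label.symm v) := by
    funext v
    simpa using congrFun (List.ofFn_injective h) (label.symm v)
  rwa [← this]

/-- The expansion of `F_P` in the basis `M_u`: by `exists_pack_iff` its coefficients only depend on
the packed word. -/
theorem FW_eq_sum {V : Type*} [PartialOrder V] {n : ℕ} (label : Fin n ≃ V) :
    FW label = ∑ u ∈ (packed_bounded n).toFinset, F label u.1 • MBasis u := by
  classical
  apply Subtype.ext
  have hM : ∀ u, ((MBasis u : WQSym) : WordSeries ℕ+) = M u := fun u =>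
    congrArg Subtype.val (Module.Basis.span_apply M_linearIndependent u)
  simp only [FW, AddSubmonoidClass.coe_finsetSum, Submodule.coe_smul, hM]
  funext w
  simp only [Finset.sum_apply, Pi.smul_apply, M, smul_eq_mul, mul_ite, mul_one, mul_zero]
  by_cases hw : w.length = n
  · rw [Finset.sum_eq_single (⟨pack w, pack_pack w⟩ : PackedWord)]
    · rw [if_pos rfl, F_apply, F_apply]
      simp only [exists_pack_iff]
    · exact fun v _ hv => if_neg fun h => hv (Subtype.ext h.symm)
    · exact fun h => absurd (by simp [pack_length, hw]) h
  · rw [Finset.sum_eq_zero, F_apply, if_neg]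
    · rintro ⟨r, -, h⟩
      exact hw (by rw [← h, List.length_ofFn])
    · intro u hu
      refine if_neg fun h => hw ?_
      rw [Set.Finite.mem_toFinset, Set.mem_ofPred_eq] at hu
      rw [← pack_length, h, hu]

theorem pack_ofFn_eq_iff {n : ℕ} (r : Fin n → ℕ+) :
    pack (List.ofFn r) = List.ofFn r ↔ IsPackedOn Finset.univ (fun i => (r i : ℕ)) := by
  have hpk : pack (List.ofFn r) = List.ofFn r ↔
      ∀ i, ((List.ofFn r).toFinset.filter (fun c => c < r i)).card + 1 = (r i : ℕ) := by
    conv_lhs => lhs; unfold pack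
    rw [List.map_ofFn, List.ofFn_inj, funext_iff]
    refine forall_congr' fun i => ?_
    rw [← PNat.coe_inj]; rfl
  rw [hpk]
  have hsub : ∀ i, ((List.ofFn r).toFinset.filter (fun c => c < r i)).image (fun c : ℕ+ => (c : ℕ))
      ⊆ Finset.Ico 1 (r i : ℕ) := by
    intro i j hj
    simp only [Finset.mem_image, Finset.mem_filter] at hj
    obtain ⟨c, ⟨-, hc⟩, rfl⟩ := hj
    exact Finset.mem_Ico.2 ⟨c.2, PNat.coe_lt_coe _ _ |>.2 hc⟩
  have hcard : ∀ i, (((List.ofFn r).toFinset.filter (fun c => c < r i)).image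
      (fun c : ℕ+ => (c : ℕ))).card = ((List.ofFn r).toFinset.filter (fun c => c < r i)).card :=
    fun i => Finset.card_image_of_injective _ PNat.coe_injective
  constructor
  · intro h
    refine ⟨fun v => by simp, fun v j hj hjv => ?_⟩
    rcases hjv.eq_or_lt with rfl | hlt
    · exact ⟨v, rfl⟩
    have heq := Finset.eq_of_subset_of_card_le (hsub v) (by
      rw [hcard, Nat.card_Ico]
      have := h v
      omega)
    have hmem : j ∈ Finset.Ico 1 (r v : ℕ) := Finset.mem_Ico.2 ⟨hj, hlt⟩
    rw [← heq] at hmem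
    simp only [Finset.mem_image, Finset.mem_filter, List.mem_toFinset, List.mem_ofFn] at hmem
    obtain ⟨_, ⟨⟨w, rfl⟩, -⟩, hw⟩ := hmem
    exact ⟨w, hw⟩
  · intro h i
    have heq := Finset.Subset.antisymm (hsub i) (fun j hj => by
      rw [Finset.mem_Ico] at hj
      obtain ⟨w, hw⟩ := h.2 i j (by omega) hj.2.le
      simp only [Finset.mem_image, Finset.mem_filter, List.mem_toFinset, List.mem_ofFn]
      dsimp only at hw
      exact ⟨r w, ⟨⟨w, rfl⟩, by rw [← PNat.coe_lt_coe]; omega⟩, hw⟩)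
    rw [← hcard, heq, Nat.card_Ico]
    have := (r i).pos
    omega

open Classical in
/-- Reindexing the evaluation of `M_u` by the composites `g = f ∘ u`. -/
theorem MEval_eq_sum {A : Type*} [Ring A] {n : ℕ} (S : VirtualAlphabet A) (r : Fin n → ℕ+)
    (u : PackedWord) (hu : u.1 = List.ofFn r) :
    MEval S u = ∑ g : Fin n → Fin S.size with ∀ x y, (r x : ℕ) ≤ r y → g x ≤ g y,
      weight S.sign g Finset.univ (fun i => (r i : ℕ)) •
        (List.ofFn fun i => S.letter (g i)).prod := by
  obtain ⟨u, hpack⟩ := u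
  dsimp only at hu
  subst hu
  have hmem : ∀ i, r i ∈ List.ofFn r := fun i => by simp
  have hex : ∀ x : {x // x ∈ List.ofFn r}, ∃ i, r i = x.1 := fun x => List.mem_ofFn.1 x.2
  choose s hs using hex
  unfold MEval
  refine Finset.sum_bij' (fun f _ i => f ⟨r i, hmem i⟩) (fun g _ x => g (s x)) ?_ ?_ ?_ ?_ ?_
  · intro f hf
    simp only [Finset.mem_filter, Finset.mem_univ, true_and] at hf ⊢
    exact fun x y hxy => hf (PNat.coe_le_coe _ _ |>.1 hxy)
  · intro g hg
    simp only [Finset.mem_filter, Finset.mem_univ, true_and] at hg ⊢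
    intro x y hxy
    refine hg _ _ ?_
    rw [hs, hs]
    exact hxy
  · intro f _
    funext x
    exact congrArg f (Subtype.ext (hs x))
  · intro g hg
    simp only [Finset.mem_filter, Finset.mem_univ, true_and] at hg
    funext i
    have := hs ⟨r i, hmem i⟩
    exact le_antisymm (hg _ _ (by rw [this])) (hg _ _ (by rw [this]))
  · intro f _
    congr 1
    · unfold weight
      refine Finset.prod_congr rfl fun j _ => ?_
      congr 1
      rw [Fintype.card_subtype, ← Finset.card_image_of_injective 
        (f := fun x : {x // x ∈ List.ofFn r} => (x.1 : ℕ)) _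
        (PNat.coe_injective.comp Subtype.val_injective)]
      congr 1
      ext k
      simp only [Finset.mem_image, Finset.mem_filter, Finset.mem_univ, true_and]
      constructor
      · rintro ⟨x, hx, rfl⟩
        exact ⟨s x, (congrArg f (Subtype.ext (hs x))).trans hx, by rw [hs]⟩
      · rintro ⟨i, hi, rfl⟩
        exact ⟨⟨r i, hmem i⟩, hi, rfl⟩
    · congr 1
      refine List.ext_getElem (by simp) fun i h1 h2 => ?_
      simp

open Classical in
/-- The expansion of `F_P` evaluated on a virtual alphabet: a signed sum over the functions with the
level condition, valid as soon as the parity of the height alternates along covers. -/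
theorem evalVirtual_FW {V A : Type*} [PartialOrder V] [Ring A] [Algebra ℚ A] {n : ℕ}
    (label : Fin n ≃ V) (hV : ∀ x y : V, x ⋖ y → (Odd (height x) ↔ ¬ Odd (height y)))
    (S : VirtualAlphabet A) :
    evalVirtual S (FW label) = ∑ g : Fin n → Fin S.size,
      (if LevelCondition (fun i j => label i ⋖ label j) (fun i => Odd (height (label i)))
          S.sign g Finset.univ then
        (-1 : ℤ) ^ (Finset.univ.filter (fun i => S.sign (g i) = Sign.minus)).card else 0) •
        (List.ofFn fun i => S.letter (g i)).prod := by
  set e : Fin n → Fin n → Prop := fun i j => label i ⋖ label j with he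
  set p : Fin n → Prop := fun i => Odd (height (label i)) with hp
  set R : Finset (Fin n → ℕ) := (Fintype.piFinset fun _ => Finset.range (n + 1)).filter
    (fun r => IsPackedOn Finset.univ r ∧ EdgeCondition e p Finset.univ r) with hR
  have hmemR : ∀ r, r ∈ R ↔ IsPackedOn Finset.univ r ∧ EdgeCondition e p Finset.univ r := by
    intro r
    simp only [hR, Finset.mem_filter, Fintype.mem_piFinset, Finset.mem_range,
      and_iff_right_iff_imp]
    intro h v
    have := h.1.le_card v
    rw [Finset.card_fin] at this
    omega
  have hpos : ∀ r ∈ R, ∀ i, ((r i).toPNat' : ℕ) = r i := by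
    intro r hr i
    rw [Nat.toPNat'_coe, if_pos]
    have := ((hmemR r).1 hr).1.1 i
    simp at this
    omega
  have h1 : evalVirtual S (FW label) = ∑ r ∈ R,
      ∑ g : Fin n → Fin S.size with ∀ x y, r x ≤ r y → g x ≤ g y,
        weight S.sign g Finset.univ r • (List.ofFn fun i => S.letter (g i)).prod := by
    rw [FW_eq_sum, map_sum]
    simp only [map_smul, evalVirtual, Module.Basis.constr_basis]
    symm
    have hpk : ∀ r ∈ R, pack (List.ofFn fun i => (r i).toPNat') =
        List.ofFn fun i => (r i).toPNat' := by
      intro r hr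
      rw [pack_ofFn_eq_iff]
      simp only [hpos r hr]
      exact ((hmemR r).1 hr).1
    refine Finset.sum_bij_ne_zero (fun r hr _ => ⟨List.ofFn fun i => (r i).toPNat', hpk r hr⟩)
      ?_ ?_ ?_ ?_
    · intro r hr _
      simp
    · intro r hr _ s hs _ h
      have := List.ofFn_injective (Subtype.mk.inj h)
      funext i
      rw [← hpos r hr, ← hpos s hs]
      exact congrArg _ (congrFun this i)
    · rintro ⟨u, hu⟩ hun hne
      rw [Set.Finite.mem_toFinset, Set.mem_ofPred_eq] at hun
      dsimp only at hun
      obtain ⟨r, rfl⟩ : ∃ r : Fin n → ℕ+, List.ofFn r = u := by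
        subst hun
        exact ⟨u.get, List.ofFn_get u⟩
      rw [F_ofFn, MEval_eq_sum S r _ rfl] at hne
      have hord : OrderCondition fun v => r (label.symm v) := by
        by_contra h
        rw [if_neg h, zero_smul] at hne
        exact hne rfl
      rw [if_pos hord, one_smul] at hne
      exact ⟨fun i => (r i : ℕ), (hmemR _).2 ⟨(pack_ofFn_eq_iff r).1 hu,
        (orderCondition_comp_symm_iff label r).1 hord⟩, hne, by simp⟩
    · intro r hr _
      rw [MEval_eq_sum S _ _ rfl, F_ofFn, if_pos, one_smul]
      · simp only [hpos r hr]
      · rw [orderCondition_comp_symm_iff label fun i => (r i).toPNat']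
        simp only [hpos r hr]
        exact ((hmemR r).1 hr).2
  rw [h1]
  simp only [Finset.sum_filter]
  rw [Finset.sum_comm]
  refine Finset.sum_congr rfl fun g _ => ?_
  have hw := sum_weight (e := e) (p := p) (σ := S.sign) (g := g)
    (fun x y hxy => hV _ _ hxy) Finset.univ
  rw [← Finset.sum_filter, ← Finset.sum_smul, ← hw]
  congr 1
  refine Finset.sum_congr ?_ fun _ _ => rfl
  ext r
  rw [Finset.mem_filter, hmemR, mem_admissible]
  simp only [IsAdmissible, Finset.mem_univ, forall_true_left, and_assoc]

end Evaluation

/-! ### Expansion of `N_P` in the letters of the virtual alphabet -/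

section Substitution

/-- The sum on the right may have infinite support, in which case both sides are `0`. -/
theorem subst_formalSum {ι X A : Type*} [Ring A] [Algebra ℚ A] (p : ι → Prop)
    {word : ι → List X} (hword : Function.Injective word) (x : X → A) :
    (formalSum p word).subst x = ∑ᶠ r ∈ {r | p r}, ((word r).map x).prod := by
  classical
  have h : ∀ w, formalSum p word w = if w ∈ word '' {r | p r} then 1 else 0 := by
    intro w
    have hsub : Subsingleton {r : ι // p r ∧ word r = w} :=
      ⟨fun r s => Subtype.ext (hword (r.2.2.trans s.2.2.symm))⟩
    unfold formalSum
    split_ifs with hw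
    · obtain ⟨r, hr⟩ := hw
      have : Nonempty {r : ι // p r ∧ word r = w} := ⟨⟨r, hr⟩⟩
      exact_mod_cast Nat.card_unique
    · have : IsEmpty {r : ι // p r ∧ word r = w} := ⟨fun r => hw ⟨r.1, r.2⟩⟩
      exact_mod_cast Nat.card_of_isEmpty
  rw [← finsum_mem_image (f := fun w : List X => (w.map x).prod) hword.injOn]
  refine finsum_congr fun w => ?_
  rw [h]
  by_cases hw : w ∈ word '' {r | p r}
  · rw [if_pos hw, one_smul, finsum_eq_if, if_pos hw]
  · rw [if_neg hw, zero_smul, finsum_eq_if, if_neg hw]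

/-- The formulas for `a_j` give `0` beyond the end of the alphabet, so that the differences
`a_j - a_{j+1}` are right at the end, and the truncation needs no separate treatment. -/
theorem aVar_eq_zero {m j : ℕ} (h : 2 * m + 1 < j) : aVar m j = 0 := by
  unfold aVar
  split_ifs with hj
  · rw [Finset.Ico_eq_empty (by omega), Finset.Ico_eq_empty (by omega)]
    simp
  · rw [Nat.not_odd_iff_even, Nat.even_iff] at hj
    rw [Finset.Ico_eq_empty (by omega), Finset.Ico_eq_empty (by omega)]
    simp

theorem aVar_odd (m t : ℕ) : aVar m (2 * t + 1) =
    ∑ k ∈ Finset.Ico t m, FreeAlgebra.ι ℚ (Letter.d k.succPNat) +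
      ∑ k ∈ Finset.Ico t (m + 1), FreeAlgebra.ι ℚ (Letter.b k.succPNat) := by
  rw [aVar, if_pos (odd_two_mul_add_one t)]
  rw [show (2 * t + 1) / 2 = t by omega]

theorem aVar_even (m t : ℕ) : aVar m (2 * t + 2) =
    ∑ k ∈ Finset.Ico t m, FreeAlgebra.ι ℚ (Letter.d k.succPNat) +
      ∑ k ∈ Finset.Ico (t + 1) (m + 1), FreeAlgebra.ι ℚ (Letter.b k.succPNat) := by
  rw [aVar, if_neg (by rw [Nat.not_odd_iff_even, Nat.even_iff]; omega)]
  rw [show (2 * t + 2) / 2 = t + 1 by omega]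
  rfl

theorem truncatedVar_b (m : ℕ) (k : ℕ+) :
    truncatedVar m (Letter.b k) = aVar m (2 * k - 1) - aVar m (2 * k) := by
  obtain ⟨t, rfl⟩ : ∃ t : ℕ, k = t.succPNat := ⟨k.natPred, (PNat.succPNat_natPred k).symm⟩
  rw [Nat.succPNat_coe, show 2 * t.succ - 1 = 2 * t + 1 by omega,
    show 2 * t.succ = 2 * t + 2 by omega, aVar_odd, aVar_even, truncatedVar, Nat.succPNat_coe]
  split_ifs with h
  · rw [Finset.sum_eq_sum_Ico_succ_bot (show t < m + 1 by omega)]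
    abel
  · rw [Finset.Ico_eq_empty (show ¬ t < m + 1 by omega),
      Finset.Ico_eq_empty (show ¬ t + 1 < m + 1 by omega)]
    simp

theorem truncatedVar_d (m : ℕ) (k : ℕ+) :
    truncatedVar m (Letter.d k) = aVar m (2 * k) - aVar m (2 * k + 1) := by
  obtain ⟨t, rfl⟩ : ∃ t : ℕ, k = t.succPNat := ⟨k.natPred, (PNat.succPNat_natPred k).symm⟩
  rw [Nat.succPNat_coe, show 2 * t.succ = 2 * t + 2 by omega, aVar_even,
    show 2 * t + 2 + 1 = 2 * (t + 1) + 1 by ring, aVar_odd, truncatedVar, Nat.succPNat_coe]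
  split_ifs with h
  · rw [Finset.sum_eq_sum_Ico_succ_bot (show t < m by omega)]
    abel
  · rw [Finset.Ico_eq_empty (show ¬ t < m by omega),
      Finset.Ico_eq_empty (show ¬ t + 1 < m by omega)]
    simp

/-- The coefficient of `a_{j+1}` in the difference `a_s - a_{s+1}`. -/
def diffCoeff (s j : ℕ) : ℚ := if j + 1 = s then 1 else if j = s then -1 else 0

theorem aVar_sub_eq_sum (m : ℕ) {s : ℕ} (hs : 0 < s) :
    aVar m s - aVar m (s + 1) =
      ∑ j : Fin (2 * m + 1), diffCoeff s j • aVar m (j + 1) := by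
  rw [Fin.sum_univ_eq_sum_range (fun j => diffCoeff s j • aVar m (j + 1))]
  have h : ∀ j, diffCoeff s j • aVar m (j + 1) =
      (if j = s - 1 then aVar m (j + 1) else 0) - if j = s then aVar m (j + 1) else 0 := by
    intro j
    unfold diffCoeff
    by_cases h1 : j = s - 1
    · rw [if_pos (by omega), if_pos h1, if_neg (by omega), one_smul, sub_zero]
    · rw [if_neg (by omega), if_neg h1]
      split_ifs <;> simp
  simp only [h, Finset.sum_sub_distrib, Finset.sum_ite_eq', Finset.mem_range]
  rw [show s - 1 + 1 = s by omega]
  congr 1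
  · split_ifs with h1
    · rfl
    · exact aVar_eq_zero (by omega)
  · split_ifs with h1
    · rfl
    · exact aVar_eq_zero (by omega)

open Classical in
/-- The position `s` for which the variable `b_k` (for an element of even height) or
`d_k` (for one of odd height) is `a_s - a_{s+1}`. -/
noncomputable def diffIndex (odd : Prop) (k : ℕ) : ℕ := if odd then 2 * k else 2 * k - 1

open Classical in
/-- The only `k` for which the variable `d_k` (for an element of odd height) or `b_k` (for one of
even height), written as `a_s - a_{s+1}`, involves `a_{j+1}`. For odd height and `j = 0` there is
none, and the value is `0`. -/
noncomputable def levelValue (odd : Prop) (j : ℕ) : ℕ := if odd then (j + 1) / 2 else j / 2 + 1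

theorem eq_levelValue_of_diffCoeff_ne_zero {odd : Prop} {k j : ℕ} (hk : 0 < k)
    (h : diffCoeff (diffIndex odd k) j ≠ 0) : k = levelValue odd j := by
  unfold diffCoeff diffIndex at h
  unfold levelValue
  by_cases ho : odd
  · simp only [ho, if_true] at h ⊢
    split_ifs at h <;> first | omega | exact absurd rfl h
  · simp only [ho, if_false] at h ⊢
    split_ifs at h <;> first | omega | exact absurd rfl h

theorem diffCoeff_levelValue {odd : Prop} [Decidable odd] {j : ℕ} (hpos : 0 < levelValue odd j) :
    diffCoeff (diffIndex odd (levelValue odd j)) j =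
      (if odd then 1 else -1) * if Odd (j + 1) then -1 else 1 := by
  unfold levelValue at hpos
  unfold diffCoeff diffIndex levelValue
  by_cases ho : odd
  · simp only [ho, if_true] at hpos ⊢
    by_cases hj : Odd (j + 1)
    · rw [if_pos hj]
      rw [Nat.odd_iff] at hj
      rw [if_neg (by omega), if_pos (by omega)]; norm_num
    · rw [if_neg hj]
      rw [Nat.not_odd_iff_even, Nat.even_iff] at hj
      rw [if_pos (by omega)]; norm_num
  · simp only [ho, if_false] at hpos ⊢
    by_cases hj : Odd (j + 1)
    · rw [if_pos hj]
      rw [Nat.odd_iff] at hj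
      rw [if_pos (by omega)]; norm_num
    · rw [if_neg hj]
      rw [Nat.not_odd_iff_even, Nat.even_iff] at hj
      rw [if_neg (by omega), if_pos (by omega)]; norm_num

/-- The signs of `AVirtual m`, indexed by the literal type `Fin (2 * m + 1)` in place of
`Fin (AVirtual m).size`, so that rewriting sees through it. -/
noncomputable def levelSign (m : ℕ) (j : Fin (2 * m + 1)) : Sign :=
  if Odd (j.1 + 1) then Sign.minus else Sign.plus

theorem levelSign_eq_minus_iff (m : ℕ) (j : Fin (2 * m + 1)) :
    levelSign m j = Sign.minus ↔ Odd (j.1 + 1) := by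
  unfold levelSign
  split_ifs with h
  · simp [h]
  · simp [h]

theorem exists_covBy_of_odd_height {V : Type*} [PartialOrder V] [Finite V] {y : V}
    (hy : Odd (height y)) : ∃ x, x ⋖ y := by
  have hmin : ¬ IsMin y := by
    intro h
    rw [height, Order.height_eq_zero.2 h] at hy
    simp at hy
  rw [not_isMin_iff] at hmin
  obtain ⟨z, hz⟩ := hmin
  obtain ⟨x, -, hx⟩ := exists_le_covBy_of_lt hz
  exact ⟨x, hx⟩

section Level

variable {V : Type*} [PartialOrder V] {n m : ℕ} {label : Fin n ≃ V} {g : Fin n → Fin (2 * m + 1)}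

/-- The level condition for the signs of `AVirtual m` is the order condition for the function
determined by the positions of the letters. -/
theorem orderCondition_iff_levelCondition
    (hV : ∀ x y : V, x ⋖ y → (Odd (height x) ↔ ¬ Odd (height y))) {r : V → ℕ+}
    (hr : ∀ i, (r (label i) : ℕ) = levelValue (Odd (height (label i))) (g i)) :
    OrderCondition r ↔ LevelCondition (fun i j => label i ⋖ label j)
      (fun i => Odd (height (label i))) (levelSign m) g Finset.univ := by
  have : Finite V := Finite.of_equiv _ label
  rw [orderCondition_iff_covBy]
  simp only [LevelCondition, label.symm.forall_congr_left, Finset.mem_univ, forall_true_left,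
    Equiv.symm_symm]
  refine forall₂_congr fun i j => forall_congr' fun hij => ?_
  have hpar := hV _ _ hij
  have hs := levelSign_eq_minus_iff m (g i)
  rw [hs, ← PNat.coe_le_coe, ← PNat.coe_lt_coe, hr, hr, Fin.le_def, Fin.ext_iff,
    Nat.odd_iff (n := (g i).1 + 1)]
  unfold levelValue
  by_cases hi : Odd (height (label i))
  · have hj := hpar.1 hi
    simp only [hi, hj, if_true, if_false, forall_true_left, iff_true]
    omega
  · have hj : Odd (height (label j)) := by tauto
    simp only [hi, hj, if_true, if_false, false_imp_iff, iff_false, and_true]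
    omega

/-- The level condition makes the function determined by the positions a function to the positive
integers. -/
theorem levelValue_pos (hV : ∀ x y : V, x ⋖ y → (Odd (height x) ↔ ¬ Odd (height y)))
    (hg : LevelCondition (fun i j => label i ⋖ label j)
      (fun i => Odd (height (label i))) (levelSign m) g Finset.univ) (i : Fin n) :
    0 < levelValue (Odd (height (label i))) (g i) := by
  have : Finite V := Finite.of_equiv _ label
  unfold levelValue
  split_ifs with hi
  · -- An element of odd height covers an element of even height, which cannot lie with it in
    -- the first level.
    obtain ⟨x, hx⟩ := exists_covBy_of_odd_height hi
    obtain ⟨j, rfl⟩ := label.surjective x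
    have h := hg j (Finset.mem_univ _) i (Finset.mem_univ _) hx
    have hs := levelSign_eq_minus_iff m (g j)
    rw [hs, Fin.le_def, Fin.ext_iff, Nat.odd_iff] at h
    have hpar := hV _ _ hx
    have hj : ¬ Odd (height (label j)) := by tauto
    simp only [hj, iff_false] at h
    omega
  · omega

open Classical in
/-- The coefficient of the word `g` on the side of `N_P`: at most one function with the order
condition contributes to it, with a sign `-1` for each letter of sign `⊖` and a further
`-1` for each element of even height. -/
theorem sum_prod_diffCoeff [Fintype V]
    (hV : ∀ x y : V, x ⋖ y → (Odd (height x) ↔ ¬ Odd (height y))) :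
    ∑ r ∈ (Fintype.piFinset fun _ : V => Finset.Icc 1 m.succPNat).filter OrderCondition,
      ∏ i, diffCoeff (diffIndex (Odd (height (label i))) (r (label i))) (g i) =
    if LevelCondition (fun i j => label i ⋖ label j)
        (fun i => Odd (height (label i))) (levelSign m) g Finset.univ then
      (-1 : ℚ) ^ Nat.card {v : V // Even (height v)} *
        (-1) ^ (Finset.univ.filter (fun i => levelSign m (g i) = Sign.minus)).card
      else 0 := by
  have hzero : ∀ r : V → ℕ+,
      ∏ i, diffCoeff (diffIndex (Odd (height (label i))) (r (label i))) (g i) ≠ 0 →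
      ∀ i, (r (label i) : ℕ) = levelValue (Odd (height (label i))) (g i) := fun r h i =>
    eq_levelValue_of_diffCoeff_ne_zero (r (label i)).pos
      (Finset.prod_ne_zero_iff.1 h i (Finset.mem_univ _))
  split_ifs with hg
  · have hpos := levelValue_pos hV hg
    set r₀ : V → ℕ+ := fun v => ⟨levelValue (Odd (height (label (label.symm v))))
      (g (label.symm v)), hpos _⟩ with hr₀
    have hr₀' : ∀ i, (r₀ (label i) : ℕ) = levelValue (Odd (height (label i))) (g i) := by
      intro i
      simp [hr₀]
    rw [Finset.sum_eq_single r₀]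
    · simp only [hr₀', diffCoeff_levelValue (hpos _), Finset.prod_mul_distrib]
      congr 1
      · rw [label.prod_comp (fun v => if Odd (height v) then (1 : ℚ) else -1), Finset.prod_ite,
          Finset.prod_const_one, one_mul, Finset.prod_const, Nat.card_eq_fintype_card,
          Fintype.card_subtype]
        simp only [Nat.not_odd_iff_even]
      · rw [Finset.prod_ite, Finset.prod_const_one, mul_one, Finset.prod_const]
        simp only [levelSign_eq_minus_iff]
    · intro r _ hne
      by_contra h
      refine hne (funext fun v => ?_)
      obtain ⟨i, rfl⟩ := label.surjective v
      exact PNat.coe_injective ((hzero r h i).trans (hr₀' i).symm)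
    · intro h
      refine absurd (Finset.mem_filter.2 ⟨Fintype.mem_piFinset.2 fun v => ?_,
        (orderCondition_iff_levelCondition hV hr₀').2 hg⟩) h
      obtain ⟨i, rfl⟩ := label.surjective v
      rw [Finset.mem_Icc]
      refine ⟨one_le, ?_⟩
      rw [← PNat.coe_le_coe, hr₀', Nat.succPNat_coe]
      have := (g i).2
      unfold levelValue
      split_ifs <;> omega
  · refine Finset.sum_eq_zero fun r hr => ?_
    by_contra h
    exact hg ((orderCondition_iff_levelCondition hV (hzero r h)).1 (Finset.mem_filter.1 hr).2)

open Classical in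
/-- The expansion of the truncated `N_P` in products of the letters of `AVirtual m`. -/
theorem N_subst_eq (hV : ∀ x y : V, x ⋖ y → (Odd (height x) ↔ ¬ Odd (height y))) :
    (N label).subst (truncatedVar m) = ∑ g : Fin n → Fin (2 * m + 1),
      (if LevelCondition (fun i j => label i ⋖ label j)
          (fun i => Odd (height (label i))) (levelSign m) g Finset.univ then
        (-1 : ℚ) ^ Nat.card {v : V // Even (height v)} *
          (-1) ^ (Finset.univ.filter (fun i => levelSign m (g i) = Sign.minus)).card
        else 0) • (List.ofFn fun i => aVar m (g i + 1)).prod := by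
  have : Fintype V := Fintype.ofEquiv _ label
  have hinj : Function.Injective (fun r : V → ℕ+ => List.ofFn fun i =>
      if Even (height (label i)) then Letter.b (r (label i)) else Letter.d (r (label i))) := by
    intro r s h
    funext v
    obtain ⟨i, rfl⟩ := label.surjective v
    have := congrFun (List.ofFn_injective h) i
    split_ifs at this
    · exact Letter.b.inj this
    · exact Letter.d.inj this
  have hvar : ∀ (r : V → ℕ+) (i : Fin n),
      truncatedVar m (if Even (height (label i)) then Letter.b (r (label i))
        else Letter.d (r (label i))) = ∑ j : Fin (2 * m + 1),
          diffCoeff (diffIndex (Odd (height (label i))) (r (label i))) j • aVar m (j + 1) := by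
    intro r i
    have hpos := (r (label i)).pos
    rw [← aVar_sub_eq_sum m (by unfold diffIndex; split_ifs <;> omega), diffIndex]
    by_cases h : Even (height (label i))
    · rw [if_pos h, if_neg (Nat.not_odd_iff_even.2 h), truncatedVar_b,
        Nat.sub_add_cancel (by omega)]
    · rw [if_neg h, if_pos (Nat.not_even_iff_odd.1 h), truncatedVar_d]
  have hterm : ∀ r : V → ℕ+, ((List.ofFn fun i => if Even (height (label i)) then
      Letter.b (r (label i)) else Letter.d (r (label i))).map (truncatedVar m)).prod =
      ∑ g : Fin n → Fin (2 * m + 1),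
        (∏ i, diffCoeff (diffIndex (Odd (height (label i))) (r (label i))) (g i)) •
          (List.ofFn fun i => aVar m (g i + 1)).prod := by
    intro r
    rw [List.map_ofFn]
    simp only [Function.comp_def, hvar]
    rw [← MultilinearMap.mkPiAlgebraFin_apply (R := ℚ), MultilinearMap.map_sum]
    refine Finset.sum_congr rfl fun g _ => ?_
    rw [MultilinearMap.map_smul_univ, MultilinearMap.mkPiAlgebraFin_apply]
  have hsupp : ∀ r : V → ℕ+, ((List.ofFn fun i => if Even (height (label i)) then
      Letter.b (r (label i)) else Letter.d (r (label i))).map (truncatedVar m)).prod ≠ 0 →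
      r ∈ Fintype.piFinset fun _ : V => Finset.Icc 1 m.succPNat := by
    intro r h
    rw [Fintype.mem_piFinset]
    intro v
    obtain ⟨i, rfl⟩ := label.surjective v
    rw [Finset.mem_Icc]
    refine ⟨one_le, ?_⟩
    by_contra hlt
    refine h (List.prod_eq_zero ?_)
    rw [List.map_ofFn, List.mem_ofFn]
    refine ⟨i, ?_⟩
    rw [← PNat.coe_le_coe, Nat.succPNat_coe] at hlt
    dsimp only [Function.comp]
    split_ifs
    · rw [truncatedVar, if_neg (by omega)]
    · rw [truncatedVar, if_neg (by omega)]
  rw [N, subst_formalSum _ hinj, finsum_mem_eq_sum_of_inter_support_eq _ (t :=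
    (Fintype.piFinset fun _ : V => Finset.Icc 1 m.succPNat).filter OrderCondition)]
  · simp only [hterm]
    rw [Finset.sum_comm]
    refine Finset.sum_congr rfl fun g _ => ?_
    rw [← Finset.sum_smul, sum_prod_diffCoeff hV]
  · ext r
    simp only [Set.mem_inter_iff, Set.mem_ofPred_eq, Function.mem_support, Finset.coe_filter]
    exact ⟨fun h => ⟨⟨hsupp r h.2, h.1⟩, h.2⟩, fun h => ⟨h.1.2, h.2⟩⟩

end Level

end Substitution

end NCPartition

theorem mainTheorem2 {V : Type*} [PartialOrder V] {n : ℕ} (label : Fin n ≃ V)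
    (hV : NCPartition.IsRanked V) (m : ℕ) :
    (NCPartition.N label).subst (NCPartition.truncatedVar m) =
      (-1 : ℚ) ^ Nat.card {v : V // Even (NCPartition.height v)} •
        NCPartition.evalVirtual (NCPartition.AVirtual m) (NCPartition.FW label) := by
  have hpar : ∀ x y : V, x ⋖ y →
      (Odd (NCPartition.height x) ↔ ¬ Odd (NCPartition.height y)) := by
    intro x y hxy
    rw [hV x y hxy, Nat.odd_add_one, not_not]
  rw [NCPartition.N_subst_eq hpar, NCPartition.evalVirtual_FW label hpar, Finset.smul_sum]
  refine Finset.sum_congr rfl fun (g : Fin n → Fin (2 * m + 1)) _ => ?_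
  rw [← Int.cast_smul_eq_zsmul ℚ, smul_smul]
  congr 1
  by_cases h : NCPartition.LevelCondition (fun i j => label i ⋖ label j)
      (fun i => Odd (NCPartition.height (label i))) (NCPartition.levelSign m) g Finset.univ
  · have h' : NCPartition.LevelCondition (fun i j => label i ⋖ label j)
        (fun i => Odd (NCPartition.height (label i))) (NCPartition.AVirtual m).sign g
        Finset.univ := h
    rw [if_pos h, if_pos h']
    push_cast
    rfl
  · have h' : ¬ NCPartition.LevelCondition (fun i j => label i ⋖ label j)
        (fun i => Odd (NCPartition.height (label i))) (NCPartition.AVirtual m).sign g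
        Finset.univ := h
    rw [if_neg h, if_neg h', Int.cast_zero, mul_zero]
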